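/- Let $M\ge 2$ and let $\mathbb F_M$ be the free group on $s_1,\dots,s_M$. Let $\mathcal T_M$ be the metric Cayley graph with vertex set $\mathbb F_M$ and directed edges $e=(v,vs_m)$, $v\in\mathbb F_M$, $1\le m\le M$, where each edge $(v,vs_m)$ is identified with the interval $[0,l_m]$ ($v$ corresponding to $0$ and $vs_m$ to $l_m$); the lengths $l_1,\dots,l_M>0$ are arbitrary. For each $m$ let $q_m:[0,l_m]\to[0,\infty)$ be bounded, measurable and even, i.e. $q_m(l_m-x)=q_m(x)$, and let $q$ be the function on $\mathcal T_M$ equal to $q_m$ on each edge $(v,vs_m)$. Let $L^2(\mathcal T_M)=\bigoplus_{e}L^2[0,l_e]$, and let $\mathcal D_{com}$ be the set of compactly supported continuous functions $f$ on $\mathcal T_M$ such that on every edge $e$ the component $f_e$ is differentiable with $f_e'$ absolutely continuous and $f_e''\in L^2[0,l_e]$, and such that at every vertex the sum, over all edges incident on it, of the derivatives of $f$ in the direction pointing from the vertex into the edge is $0$. Let $\Delta+q$ be the Friedrichs extension in $L^2(\mathcal T_M)$ of the symmetric nonnegative operator $f\mapsto -f''+qf$ with domain $\mathcal D_{com}$.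 Then the spectrum of $\Delta+q$ has a strictly positive lower bound: there is a constant $c>0$ such that $\sigma(\Delta+q)\subseteq[c,\infty)$. -/

import Mathlib

open MeasureTheory Filter Topology Set
open scoped ComplexConjugate

noncomputable section

/-! ### Unbounded operators: Friedrichs extension and spectrum -/

section Operators

variable {H : Type*} [NormedAddCommGroup H] [InnerProductSpace ℂ H]

/-- `S` is symmetric and nonnegative on its domain. -/
def IsSymmNonneg (S : H →ₗ.[ℂ] H) : Prop :=
  S.IsFormalAdjoint S ∧ ∀ x : S.domain, 0 ≤ (inner ℂ (x : H) (S x)).re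

/-- The quadratic form `u ↦ ⟨S u, u⟩` of an operator (real if `S` is symmetric). -/
def quadForm (S : H →ₗ.[ℂ] H) (u : S.domain) : ℝ := (inner ℂ (u : H) (S u)).re

lemma quadForm_smul (S : H →ₗ.[ℂ] H) (c : ℂ) (u : S.domain) :
    quadForm S (c • u) = ‖c‖ ^ 2 * quadForm S u := by
  unfold quadForm
  rw [LinearPMap.map_smul, Submodule.coe_smul, inner_smul_left, inner_smul_right, ← mul_assoc,
    Complex.conj_mul']
  norm_cast
  rw [Complex.re_ofReal_mul]

lemma quadForm_add_le {S : H →ₗ.[ℂ] H} (hS : IsSymmNonneg S) (u v : S.domain) :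
    quadForm S (u + v) ≤ 2 * quadForm S u + 2 * quadForm S v := by
  have h : quadForm S (u + v) + quadForm S (u - v) = 2 * quadForm S u + 2 * quadForm S v := by
    unfold quadForm
    rw [LinearPMap.map_add, LinearPMap.map_sub, Submodule.coe_add, Submodule.coe_sub]
    simp only [inner_add_left, inner_add_right, inner_sub_left, inner_sub_right,
      Complex.add_re, Complex.sub_re]
    ring
  have := hS.2 (u - v)
  unfold quadForm at *
  linarith

/-- The form domain of a symmetric nonnegative operator `S`: all limits in `H` of sequences in
the domain of `S` which are Cauchy for the quadratic form of `S`. -/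
def formDomain (S : H →ₗ.[ℂ] H) (hS : IsSymmNonneg S) : Submodule ℂ H where
  carrier := {x | ∃ u : ℕ → S.domain, Tendsto (fun n => (u n : H)) atTop (𝓝 x) ∧
    Tendsto (fun p : ℕ × ℕ => quadForm S (u p.1 - u p.2)) atTop (𝓝 0)}
  zero_mem' := ⟨fun _ => 0, by simp, by simp [quadForm]⟩
  add_mem' := by
    rintro x y ⟨u, hu, hu'⟩ ⟨v, hv, hv'⟩
    refine ⟨fun n => u n + v n, by simpa using hu.add hv, ?_⟩
    have h := (hu'.const_mul 2).add (hv'.const_mul 2)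
    simp only [mul_zero, add_zero] at h
    refine squeeze_zero (fun p => hS.2 _) (fun p => ?_) h
    rw [add_sub_add_comm]
    exact quadForm_add_le hS _ _
  smul_mem' := by
    rintro c x ⟨u, hu, hu'⟩
    refine ⟨fun n => c • u n, by simpa using hu.const_smul c, ?_⟩
    simp only [← smul_sub, quadForm_smul]
    simpa using hu'.const_mul (‖c‖ ^ 2)

/-- The Friedrichs extension of a (densely defined) symmetric nonnegative operator: the
restriction of the adjoint of `S` to the intersection of its domain with the form domain. -/
def friedrichsExtension [CompleteSpace H] (S : H →ₗ.[ℂ] H) (hS : IsSymmNonneg S) :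
    H →ₗ.[ℂ] H :=
  S.adjoint.domRestrict (formDomain S hS)

/-- The spectrum of an unbounded operator `A`: those `z ∈ ℂ` for which `A - z` does not have a
bounded everywhere defined two-sided inverse. -/
def unboundedSpectrum (A : H →ₗ.[ℂ] H) : Set ℂ :=
  {z | ¬ ∃ R : H →L[ℂ] H,
    (∀ y : H, ∃ h : R y ∈ A.domain, A ⟨R y, h⟩ - z • R y = y) ∧
    ∀ x : A.domain, R (A x - z • (x : H)) = x}

end Operators

/-! ### The metric Cayley graph of the free group -/

/-- The directed edges `(v, v s_m)` of the Cayley graph of the free group on `s_1, …, s_M`;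
such an edge is recorded as the pair `(v, m)`. -/
abbrev TreeEdge (M : ℕ) : Type := FreeGroup (Fin M) × Fin M

/-- `L²` of the metric graph: the Hilbert space direct sum over all edges `e` of `L²[0, l_e]`,
where every edge of type `m` has length `l m`. -/
abbrev TreeL2 {M : ℕ} (l : Fin M → ℝ) : Type :=
  lp (fun e : TreeEdge M => Lp ℂ 2 (volume.restrict (Icc 0 (l e.2)))) 2

/-- `F₁` is the first derivative of `F` on `[0, L]`, it is absolutely continuous there, and `F₂`,
its almost everywhere derivative, is square integrable. -/
structure IsH2 (L : ℝ) (F F₁ F₂ : ℝ → ℂ) : Prop where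
  hasDeriv : ∀ x ∈ Icc 0 L, HasDerivWithinAt F (F₁ x) (Icc 0 L) x
  absCont : AbsolutelyContinuousOnInterval F₁ 0 L
  hasDeriv₂ : ∀ᵐ x ∂volume.restrict (Icc 0 L), HasDerivAt F₁ (F₂ x) x
  memLp : MemLp F₂ 2 (volume.restrict (Icc 0 L))

/-- `F`, with edgewise first and second derivatives `F₁` and `F₂`, is in the domain of compactly
supported functions:
* every component has an absolutely continuous derivative and a square integrable second
  derivative;
* `F` is continuous at every vertex `v`, where `φ v` is its value; the edge `(v, m)` starts
  (coordinate `0`) at `v` and ends (coordinate `l m`) at `v s_m`;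
* at every vertex the derivatives, taken in the direction away from the vertex, sum to zero; the
  edges at `v` are `(v, m)`, which starts at `v`, and `(v s_m⁻¹, m)`, which ends at `v`;
* the support is compact, that is, `F` vanishes on all but finitely many edges. -/
structure IsDcom {M : ℕ} (l : Fin M → ℝ) (F F₁ F₂ : TreeEdge M → ℝ → ℂ) : Prop where
  isH2 : ∀ e, IsH2 (l e.2) (F e) (F₁ e) (F₂ e)
  continuous_vertex : ∃ φ : FreeGroup (Fin M) → ℂ, ∀ v m,
    F (v, m) 0 = φ v ∧ F (v, m) (l m) = φ (v * FreeGroup.of m)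
  sum_deriv : ∀ v : FreeGroup (Fin M),
    ∑ m, (F₁ (v, m) 0 - F₁ (v * (FreeGroup.of m)⁻¹, m) (l m)) = 0
  compactSupport : {e : TreeEdge M | ∃ x ∈ Icc 0 (l e.2), F e x ≠ 0}.Finite

lemma IsH2.add {L : ℝ} {F F₁ F₂ G G₁ G₂ : ℝ → ℂ} (hF : IsH2 L F F₁ F₂) (hG : IsH2 L G G₁ G₂) :
    IsH2 L (F + G) (F₁ + G₁) (F₂ + G₂) where
  hasDeriv x hx := (hF.hasDeriv x hx).add (hG.hasDeriv x hx)
  absCont := hF.absCont.add hG.absCont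
  hasDeriv₂ := by
    filter_upwards [hF.hasDeriv₂, hG.hasDeriv₂] with x h h' using h.add h'
  memLp := hF.memLp.add hG.memLp

lemma IsH2.smul {L : ℝ} {F F₁ F₂ : ℝ → ℂ} (c : ℂ) (hF : IsH2 L F F₁ F₂) :
    IsH2 L (c • F) (c • F₁) (c • F₂) where
  hasDeriv x hx := (hF.hasDeriv x hx).const_smul c
  absCont := hF.absCont.const_smul c
  hasDeriv₂ := by filter_upwards [hF.hasDeriv₂] with x h using h.const_smul c
  memLp := hF.memLp.const_smul c

lemma IsDcom.add {M : ℕ} {l : Fin M → ℝ} {F F₁ F₂ G G₁ G₂ : TreeEdge M → ℝ → ℂ}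
    (hF : IsDcom l F F₁ F₂) (hG : IsDcom l G G₁ G₂) : IsDcom l (F + G) (F₁ + G₁) (F₂ + G₂) where
  isH2 e := (hF.isH2 e).add (hG.isH2 e)
  continuous_vertex := by
    obtain ⟨φ, hφ⟩ := hF.continuous_vertex
    obtain ⟨ψ, hψ⟩ := hG.continuous_vertex
    exact ⟨φ + ψ, fun v m => by simp [hφ, hψ]⟩
  sum_deriv v := by
    have h := congrArg₂ (· + ·) (hF.sum_deriv v) (hG.sum_deriv v)
    simp only [← Finset.sum_add_distrib, add_zero] at h
    rw [← h]
    exact Finset.sum_congr rfl fun m _ => by simp only [Pi.add_apply]; ring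
  compactSupport := by
    refine (hF.compactSupport.union hG.compactSupport).subset ?_
    rintro e ⟨x, hx, h⟩
    by_contra hc
    simp only [mem_union, mem_ofPred_eq, not_or, not_exists, not_and, not_not] at hc
    exact h (by simp [hc.1 x hx, hc.2 x hx])

lemma IsDcom.smul {M : ℕ} {l : Fin M → ℝ} {F F₁ F₂ : TreeEdge M → ℝ → ℂ} (c : ℂ)
    (hF : IsDcom l F F₁ F₂) : IsDcom l (c • F) (c • F₁) (c • F₂) where
  isH2 e := (hF.isH2 e).smul c
  continuous_vertex := by
    obtain ⟨φ, hφ⟩ := hF.continuous_vertex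
    exact ⟨c • φ, fun v m => by simp [hφ]⟩
  sum_deriv v := by
    have h := congrArg (c * ·) (hF.sum_deriv v)
    simpa [Finset.mul_sum, mul_sub] using h
  compactSupport := by
    refine hF.compactSupport.subset ?_
    rintro e ⟨x, hx, h⟩
    exact ⟨x, hx, fun h0 => h (by simp [h0])⟩

lemma IsDcom.zero {M : ℕ} (l : Fin M → ℝ) : IsDcom l 0 0 0 where
  isH2 e :=
    { hasDeriv := fun x _ => hasDerivWithinAt_const x _ (0 : ℂ)
      absCont := by simp [AbsolutelyContinuousOnInterval, tendsto_const_nhds]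
      hasDeriv₂ := Eventually.of_forall fun x => hasDerivAt_const x (0 : ℂ)
      memLp := MemLp.zero }
  continuous_vertex := ⟨0, by simp⟩
  sum_deriv v := by simp
  compactSupport := by simp

/-- The graph of `-D² + q` on the domain of compactly supported functions: all pairs
`(f, -f'' + q f)` of elements of `L²`; the potential is `q m` on each edge of type `m`. -/
def minimalGraph {M : ℕ} (l : Fin M → ℝ) (q : Fin M → ℝ → ℝ) :
    Submodule ℂ (TreeL2 l × TreeL2 l) where
  carrier := {p | ∃ F F₁ F₂ : TreeEdge M → ℝ → ℂ, IsDcom l F F₁ F₂ ∧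
    ∀ e, p.1 e =ᵐ[volume.restrict (Icc 0 (l e.2))] F e ∧
      p.2 e =ᵐ[volume.restrict (Icc 0 (l e.2))] fun x => -F₂ e x + q e.2 x * F e x}
  zero_mem' := by
    refine ⟨0, 0, 0, IsDcom.zero l, fun e => ⟨?_, ?_⟩⟩
    · exact Lp.coeFn_zero _ _ _
    · filter_upwards [Lp.coeFn_zero ℂ 2 (volume.restrict (Icc 0 (l e.2)))] with x hx
      simpa using hx
  add_mem' := by
    rintro a b ⟨F, F₁, F₂, hF, ha⟩ ⟨G, G₁, G₂, hG, hb⟩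
    refine ⟨F + G, F₁ + G₁, F₂ + G₂, hF.add hG, fun e => ⟨?_, ?_⟩⟩
    · filter_upwards [(ha e).1, (hb e).1, Lp.coeFn_add (a.1 e) (b.1 e)] with x h1 h2 h3
      simpa [h1, h2] using h3
    · filter_upwards [(ha e).2, (hb e).2, Lp.coeFn_add (a.2 e) (b.2 e)] with x h1 h2 h3
      refine Eq.trans h3 ?_
      simp only [Pi.add_apply, h1, h2]
      ring
  smul_mem' := by
    rintro c a ⟨F, F₁, F₂, hF, ha⟩
    refine ⟨c • F, c • F₁, c • F₂, hF.smul c, fun e => ⟨?_, ?_⟩⟩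
    · filter_upwards [(ha e).1, Lp.coeFn_smul c (a.1 e)] with x h1 h3
      simpa [h1] using h3
    · filter_upwards [(ha e).2, Lp.coeFn_smul c (a.2 e)] with x h1 h3
      refine Eq.trans h3 ?_
      simp only [Pi.smul_apply, smul_eq_mul, h1]
      ring

/-- The operator `-D² + q` with the compactly supported functions as its domain. -/
def minimalOp {M : ℕ} (l : Fin M → ℝ) (q : Fin M → ℝ → ℝ) : TreeL2 l →ₗ.[ℂ] TreeL2 l :=
  (minimalGraph l q).toLinearPMap

/-! ### The minimal operator is well defined, symmetric and nonnegative -/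

lemma IsH2.continuousOn {L : ℝ} {F F₁ F₂ : ℝ → ℂ} (hF : IsH2 L F F₁ F₂) :
    ContinuousOn F (Icc 0 L) := fun x hx => (hF.hasDeriv x hx).continuousWithinAt

lemma IsH2.continuousOn₁ {L : ℝ} (hL : 0 < L) {F F₁ F₂ : ℝ → ℂ} (hF : IsH2 L F F₁ F₂) :
    ContinuousOn F₁ (Icc 0 L) := by
  simpa [uIcc_of_le hL.le] using hF.absCont.continuousOn

lemma ae_interior (L : ℝ) : ∀ᵐ x ∂volume.restrict (Icc 0 L), x ∈ Ioo 0 L := by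
  rw [← Measure.restrict_congr_set (Ioo_ae_eq_Icc (α := ℝ) (a := 0) (b := L))]
  exact ae_restrict_mem measurableSet_Ioo

lemma IsH2.eq_zero {L : ℝ} (hL : 0 < L) {F F₁ F₂ : ℝ → ℂ} (hF : IsH2 L F F₁ F₂)
    (h : ∀ x ∈ Icc 0 L, F x = 0) :
    (∀ x ∈ Icc 0 L, F₁ x = 0) ∧ ∀ᵐ x ∂volume.restrict (Icc 0 L), F₂ x = 0 := by
  have h1 : ∀ x ∈ Icc 0 L, F₁ x = 0 := fun x hx =>
    (uniqueDiffOn_Icc hL x hx).eq_deriv _ (hF.hasDeriv x hx)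
      ((hasDerivWithinAt_const x _ (0 : ℂ)).congr h (h x hx))
  refine ⟨h1, ?_⟩
  filter_upwards [hF.hasDeriv₂, ae_interior L] with x hx hx'
  refine hx.unique ((hasDerivAt_const x (0 : ℂ)).congr_of_eventuallyEq ?_)
  filter_upwards [Ioo_mem_nhds hx'.1 hx'.2] with y hy using h1 y (Ioo_subset_Icc_self hy)

/-- The minimal graph is the graph of an operator. -/
lemma minimalGraph_single {M : ℕ} {l : Fin M → ℝ} (hl : ∀ m, 0 < l m) (q : Fin M → ℝ → ℝ)
    (p : TreeL2 l × TreeL2 l) (hp : p ∈ minimalGraph l q) (h0 : p.1 = 0) : p.2 = 0 := by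
  obtain ⟨F, F₁, F₂, hF, hp⟩ := hp
  ext1
  funext e
  have hz : ∀ x ∈ Icc 0 (l e.2), F e x = 0 := by
    refine Measure.eqOn_Icc_of_ae_eq volume (hl e.2).ne (g := fun _ => 0) ?_
      (hF.isH2 e).continuousOn continuousOn_const
    have h1 := (hp e).1
    rw [h0] at h1
    filter_upwards [h1, Lp.coeFn_zero ℂ 2 (volume.restrict (Icc 0 (l e.2)))] with x hx hx'
    exact hx.symm.trans hx'
  refine Lp.ext ?_
  filter_upwards [(hp e).2, Lp.coeFn_zero ℂ 2 (volume.restrict (Icc 0 (l e.2))),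
    ((hF.isH2 e).eq_zero (hl e.2) hz).2, ae_restrict_mem measurableSet_Icc] with x h1 h2 h3 h4
  refine h1.trans (Eq.trans ?_ h2.symm)
  simp [h3, hz x h4]

lemma minimalOp_mem {M : ℕ} {l : Fin M → ℝ} (hl : ∀ m, 0 < l m) (q : Fin M → ℝ → ℝ)
    (x : (minimalOp l q).domain) : ((x : TreeL2 l), minimalOp l q x) ∈ minimalGraph l q :=
  Submodule.mem_graph_toLinearPMap (minimalGraph_single hl q) x

lemma integral_of_absCont_re {L : ℝ} (hL : 0 < L) {f f' : ℝ → ℂ}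
    (hf : AbsolutelyContinuousOnInterval f 0 L)
    (hf' : ∀ᵐ x ∂volume.restrict (Icc 0 L), HasDerivAt f (f' x) x) :
    ∫ x in Icc 0 L, (f' x).re = (f L).re - (f 0).re := by
  have hre : AbsolutelyContinuousOnInterval (fun x => (f x).re) 0 L := by
    refine squeeze_zero (fun t => Finset.sum_nonneg fun i _ => dist_nonneg) (fun t => ?_) hf
    refine Finset.sum_le_sum fun i _ => ?_
    rw [dist_eq_norm, dist_eq_norm, ← Complex.sub_re]
    exact Complex.abs_re_le_norm _
  rw [← hre.integral_deriv_eq_sub, intervalIntegral.integral_of_le hL.le,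
    ← integral_Icc_eq_integral_Ioc]
  refine integral_congr_ae ?_
  filter_upwards [hf'] with x hx
  have := (Complex.reCLM.hasFDerivAt.comp_hasDerivAt x hx).deriv
  exact this.symm

lemma integral_of_absCont {L : ℝ} (hL : 0 < L) {f f' : ℝ → ℂ}
    (hf : AbsolutelyContinuousOnInterval f 0 L)
    (hf' : ∀ᵐ x ∂volume.restrict (Icc 0 L), HasDerivAt f (f' x) x)
    (hi : IntegrableOn f' (Icc 0 L)) :
    ∫ x in Icc 0 L, f' x = f L - f 0 := by
  have h1 := integral_of_absCont_re hL hf hf'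
  have h2 := integral_of_absCont_re hL (hf.const_smul (-Complex.I))
    (f' := fun x => -Complex.I • f' x) (by
      filter_upwards [hf'] with x hx using hx.const_smul (-Complex.I))
  simp only [smul_eq_mul, neg_mul, Complex.neg_re, Complex.I_mul_re, neg_neg] at h2
  have e1 : (∫ x in Icc 0 L, f' x).re = ∫ x in Icc 0 L, (f' x).re :=
    (integral_re (𝕜 := ℂ) hi).symm
  have e2 : (∫ x in Icc 0 L, f' x).im = ∫ x in Icc 0 L, (f' x).im :=
    (integral_im (𝕜 := ℂ) hi).symm
  apply Complex.ext
  · rw [e1, h1, Complex.sub_re]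
  · rw [e2, h2, Complex.sub_im]

lemma IsH2.absCont_conj {L : ℝ} (hL : 0 < L) {F F₁ F₂ : ℝ → ℂ} (hF : IsH2 L F F₁ F₂) :
    AbsolutelyContinuousOnInterval (fun x => conj (F x)) 0 L := by
  obtain ⟨C, hC⟩ := isCompact_Icc.exists_bound_of_continuousOn (hF.continuousOn₁ hL)
  have hlip : LipschitzOnWith (Real.toNNReal C) F (Icc 0 L) :=
    (convex_Icc 0 L).lipschitzOnWith_of_nnnorm_hasDerivWithin_le hF.hasDeriv fun x hx => by
      rw [← NNReal.coe_le_coe, coe_nnnorm]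
      exact (hC x hx).trans (Real.le_coe_toNNReal C)
  rw [← uIcc_of_le hL.le] at hlip
  refine LipschitzOnWith.absolutelyContinuousOnInterval (K := Real.toNNReal C) ?_
  intro x hx y hy
  have : edist (conj (F x)) (conj (F y)) = edist (F x) (F y) :=
    Complex.isometry_conj.edist_eq _ _
  rw [this]
  exact hlip hx hy

/-- The form `∫ (conj F') G' + q (conj F) G` on an edge. -/
def edgeForm (L : ℝ) (q : ℝ → ℝ) (F F₁ G G₁ : ℝ → ℂ) : ℂ :=
  ∫ x in Icc 0 L, (conj (F₁ x) * G₁ x + q x * (conj (F x) * G x))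

lemma edge_by_parts {L : ℝ} (hL : 0 < L) {F F₁ F₂ G G₁ G₂ : ℝ → ℂ} (q : ℝ → ℝ)
    (hF : IsH2 L F F₁ F₂) (hG : IsH2 L G G₁ G₂)
    (hq : MemLp (fun x => -G₂ x + q x * G x) 2 (volume.restrict (Icc 0 L))) :
    ∫ x in Icc 0 L, conj (F x) * (-G₂ x + q x * G x) =
      edgeForm L q F F₁ G G₁ - (conj (F L) * G₁ L - conj (F 0) * G₁ 0) := by
  have hFc : ContinuousOn (fun x => conj (F x)) (Icc 0 L) :=
    Complex.continuous_conj.comp_continuousOn hF.continuousOn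
  have hFc1 : ContinuousOn (fun x => conj (F₁ x)) (Icc 0 L) :=
    Complex.continuous_conj.comp_continuousOn (hF.continuousOn₁ hL)
  have i1 : IntegrableOn (fun x => conj (F x) * (-G₂ x + q x * G x)) (Icc 0 L) :=
    IntegrableOn.continuousOn_mul hFc (hq.integrable (by norm_num)) isCompact_Icc
  have i2 : IntegrableOn (fun x => conj (F x) * G₂ x) (Icc 0 L) :=
    IntegrableOn.continuousOn_mul hFc (hG.memLp.integrable (by norm_num)) isCompact_Icc
  have i3 : IntegrableOn (fun x => conj (F₁ x) * G₁ x) (Icc 0 L) :=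
    (hFc1.mul (hG.continuousOn₁ hL)).integrableOn_compact isCompact_Icc
  have key := integral_of_absCont hL (f := fun x => conj (F x) * G₁ x)
    (f' := fun x => conj (F₁ x) * G₁ x + conj (F x) * G₂ x)
    ((hF.absCont_conj hL).smul hG.absCont) (by
      filter_upwards [hG.hasDeriv₂, ae_interior L] with x hx hx'
      have h1 : HasDerivAt F (F₁ x) x :=
        (hF.hasDeriv x (Ioo_subset_Icc_self hx')).hasDerivAt (Icc_mem_nhds hx'.1 hx'.2)
      have h2 : HasDerivAt (fun x => conj (F x)) (conj (F₁ x)) x := by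
        exact Complex.conjCLE.toContinuousLinearMap.hasFDerivAt.comp_hasDerivAt x h1
      exact h2.mul hx) (i3.add i2)
  rw [← key, edgeForm, eq_sub_iff_add_eq]
  refine (integral_add i1 (i3.add i2)).symm.trans ?_
  congr 1
  funext x
  simp only [Pi.add_apply]
  ring

/-- The boundary terms cancel by the vertex conditions. -/
lemma boundary_sum {M : ℕ} {l : Fin M → ℝ} (hl : ∀ m, 0 < l m)
    {F F₁ F₂ G G₁ G₂ : TreeEdge M → ℝ → ℂ} (hF : IsDcom l F F₁ F₂) (hG : IsDcom l G G₁ G₂) :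
    ∑' e : TreeEdge M, (conj (F e (l e.2)) * G₁ e (l e.2) - conj (F e 0) * G₁ e 0) = 0 := by
  obtain ⟨φ, hφ⟩ := hF.continuous_vertex
  have hA : Summable fun e : TreeEdge M => conj (F e (l e.2)) * G₁ e (l e.2) := by
    refine summable_of_hasFiniteSupport (hF.compactSupport.subset fun e he => ?_)
    exact ⟨l e.2, ⟨(hl e.2).le, le_rfl⟩, fun h => he (by simp [h])⟩
  have hB : Summable fun e : TreeEdge M => conj (F e 0) * G₁ e 0 := by
    refine summable_of_hasFiniteSupport (hF.compactSupport.subset fun e he => ?_)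
    exact ⟨0, ⟨le_rfl, (hl e.2).le⟩, fun h => he (by simp [h])⟩
  let σ : TreeEdge M ≃ TreeEdge M :=
    { toFun := fun e => (e.1 * (FreeGroup.of e.2)⁻¹, e.2)
      invFun := fun e => (e.1 * FreeGroup.of e.2, e.2)
      left_inv := fun e => by simp
      right_inv := fun e => by simp }
  have hA' := (σ.summable_iff).2 hA
  have hAσ := σ.tsum_eq fun e : TreeEdge M => conj (F e (l e.2)) * G₁ e (l e.2)
  rw [hA.tsum_sub hB, ← hAσ]
  refine (hA'.tsum_sub hB).symm.trans ?_
  rw [(hA'.sub hB).tsum_prod]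
  refine (tsum_congr fun v => ?_).trans tsum_zero
  rw [tsum_fintype]
  have h := congrArg (fun z => -(conj (φ v) * z)) (hG.sum_deriv v)
  simp only [mul_zero, neg_zero, Finset.mul_sum, ← Finset.sum_neg_distrib] at h
  rw [← h]
  refine Finset.sum_congr rfl fun m _ => ?_
  have h1 : F (v * (FreeGroup.of m)⁻¹, m) (l m) = φ v := by
    rw [(hφ _ m).2, inv_mul_cancel_right]
  simp only [σ, Equiv.coe_fn_mk, Function.comp, h1, (hφ v m).1]
  ring

lemma inner_eq_form {M : ℕ} {l : Fin M → ℝ} (hl : ∀ m, 0 < l m) (q : Fin M → ℝ → ℝ)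
    {F F₁ F₂ G G₁ G₂ : TreeEdge M → ℝ → ℂ} (hF : IsDcom l F F₁ F₂) (hG : IsDcom l G G₁ G₂)
    (f g : TreeL2 l) (hf : ∀ e, f e =ᵐ[volume.restrict (Icc 0 (l e.2))] F e)
    (hg : ∀ e, g e =ᵐ[volume.restrict (Icc 0 (l e.2))]
      fun x => -G₂ e x + q e.2 x * G e x) :
    inner ℂ f g = ∑' e : TreeEdge M, edgeForm (l e.2) (q e.2) (F e) (F₁ e) (G e) (G₁ e) := by
  have hI : ∀ e, inner ℂ (f e) (g e) = edgeForm (l e.2) (q e.2) (F e) (F₁ e) (G e) (G₁ e) -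
      (conj (F e (l e.2)) * G₁ e (l e.2) - conj (F e 0) * G₁ e 0) := fun e => by
    rw [← edge_by_parts (hl e.2) (q e.2) (hF.isH2 e) (hG.isH2 e)
      ((memLp_congr_ae (hg e)).1 (Lp.memLp (g e))), L2.inner_def]
    refine integral_congr_ae ?_
    filter_upwards [hf e, hg e] with x h1 h2
    rw [h1, h2, RCLike.inner_apply, mul_comm]
  have hs1 : Summable fun e : TreeEdge M =>
      edgeForm (l e.2) (q e.2) (F e) (F₁ e) (G e) (G₁ e) := by
    refine summable_of_hasFiniteSupport (hF.compactSupport.subset fun e he => ?_)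
    by_contra hc
    simp only [mem_ofPred_eq, not_exists, not_and, not_not] at hc
    refine he (setIntegral_eq_zero_of_forall_eq_zero fun x hx => ?_)
    simp [hc x hx, ((hF.isH2 e).eq_zero (hl e.2) hc).1 x hx]
  have hs2 : Summable fun e : TreeEdge M =>
      conj (F e (l e.2)) * G₁ e (l e.2) - conj (F e 0) * G₁ e 0 := by
    refine summable_of_hasFiniteSupport (hF.compactSupport.subset fun e he => ?_)
    by_contra hc
    simp only [mem_ofPred_eq, not_exists, not_and, not_not] at hc
    exact he (by simp [hc _ ⟨(hl e.2).le, le_rfl⟩, hc _ ⟨le_rfl, (hl e.2).le⟩])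
  rw [lp.inner_eq_tsum, tsum_congr hI, hs1.tsum_sub hs2, boundary_sum hl hF hG, sub_zero]

lemma minimalOp_symmNonneg {M : ℕ} {l : Fin M → ℝ} (hl : ∀ m, 0 < l m) {q : Fin M → ℝ → ℝ}
    (hq : ∀ m, ∀ x ∈ Icc 0 (l m), 0 ≤ q m x) : IsSymmNonneg (minimalOp l q) := by
  constructor
  · intro x y
    obtain ⟨F, F₁, F₂, hF, hx⟩ := minimalOp_mem hl q x
    obtain ⟨G, G₁, G₂, hG, hy⟩ := minimalOp_mem hl q y
    rw [← inner_conj_symm, inner_eq_form hl q hG hF y _ (fun e => (hy e).1) (fun e => (hx e).2),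
      inner_eq_form hl q hF hG x _ (fun e => (hx e).1) (fun e => (hy e).2), Complex.conj_tsum]
    refine tsum_congr fun e => ?_
    rw [edgeForm, edgeForm, ← integral_conj]
    congr 1
    funext t
    simp only [map_add, map_mul, Complex.conj_conj, Complex.conj_ofReal]
    ring
  · intro x
    obtain ⟨F, F₁, F₂, hF, hx⟩ := minimalOp_mem hl q x
    rw [inner_eq_form hl q hF hF x _ (fun e => (hx e).1) (fun e => (hx e).2)]
    have he : ∀ e : TreeEdge M, edgeForm (l e.2) (q e.2) (F e) (F₁ e) (F e) (F₁ e) =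
        ((∫ t in Icc 0 (l e.2), (‖F₁ e t‖ ^ 2 + q e.2 t * ‖F e t‖ ^ 2) : ℝ) : ℂ) := fun e => by
      rw [edgeForm, ← integral_complex_ofReal]
      congr 1
      funext t
      rw [Complex.conj_mul', Complex.conj_mul']
      push_cast
      ring
    rw [tsum_congr he, ← Complex.ofReal_tsum, Complex.ofReal_re]
    refine tsum_nonneg fun e => setIntegral_nonneg measurableSet_Icc fun t ht => ?_
    have := hq e.2 t ht
    positivity

/-- The operator `Δ + q` on the metric Cayley graph of the free group on `M` generators, with
edges of type `m` of length `l m` and potential `q m` on each of them: the Friedrichs extension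
of `-D² + q` on compactly supported functions. -/
def treeOperator {M : ℕ} (l : Fin M → ℝ) (q : Fin M → ℝ → ℝ) (hl : ∀ m, 0 < l m)
    (hq : ∀ m, ∀ x ∈ Icc 0 (l m), 0 ≤ q m x) : TreeL2 l →ₗ.[ℂ] TreeL2 l :=
  friedrichsExtension (minimalOp l q) (minimalOp_symmNonneg hl hq)

end

/-! The tree branches, so an outward flow can spread at a definite rate, and this forces a Poincaré
inequality on functions of compact support. Give each edge a field `x + b` with slope `1` in the
edge coordinate. Integrating the derivative of `(x + b) ‖F‖ ^ 2` and summing over edges bounds `∫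
‖F‖ ^ 2` by `∫ ‖F'‖ ^ 2` plus vertex terms: `‖F‖ ^ 2` at the vertex times the net inward flux. The
offsets `flowOffset` make the flow away from the root `1` start at strength `A` on each edge and end
at `A + l m`, at most `2 * A`. A vertex other than the root receives at most `2 * A` through one
edge and sends `A` into each of the other `2 * M - 1 ≥ 3`, so all vertex terms are nonpositive
(`boundary_flow_nonpos`) and `tree_poincare` follows. Since `q ≥ 0`, the quadratic form inherits the
bound.

A lower bound `c` for the form passes to the Friedrichs extension because the completion `V` of the
form maps to `H` by a bounded `J`, and `J J*` inverts the extension. This inverse is positive of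
norm at most `c⁻¹`, so its spectrum lies in `[0, c⁻¹]`. -/

noncomputable section

/-! ### The spectrum of the Friedrichs extension of an operator bounded below -/

section Friedrichs

universe u

variable {H : Type*} [NormedAddCommGroup H] [InnerProductSpace ℂ H]

/-- The inner product `⟨u, S v⟩` on the domain of an operator `S` with a positive lower bound. -/
abbrev formCore (S : H →ₗ.[ℂ] H) (hS : IsSymmNonneg S) {c : ℝ} (hc : 0 < c)
    (h : ∀ u : S.domain, c * ‖(u : H)‖ ^ 2 ≤ quadForm S u) :
    InnerProductSpace.Core ℂ S.domain where
  inner u v := inner ℂ (u : H) (S v)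
  conj_inner_symm u v := by
    rw [inner_conj_symm]
    exact hS.1 u v
  re_inner_nonneg u := hS.2 u
  add_left u v w := by rw [Submodule.coe_add, inner_add_left]
  smul_left u v r := by rw [Submodule.coe_smul, inner_smul_left]
  definite u hu := by
    have h1 := h u
    rw [quadForm, show inner ℂ (u : H) (S u) = 0 from hu, Complex.zero_re] at h1
    have h2 : ‖(u : H)‖ ^ 2 = 0 := le_antisymm (nonpos_of_mul_nonpos_right h1 hc) (sq_nonneg _)
    exact Subtype.ext (by simpa using h2)

/-- A space with a positive definite form which bounds the norm of `ι` can be completed to a Hilbert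
space, to which `ι` extends. -/
lemma exists_core_completion [CompleteSpace H] {D : Type u} [AddCommGroup D] [Module ℂ D]
    (core : InnerProductSpace.Core ℂ D) (ι : D →ₗ[ℂ] H) {c : ℝ} (hc : 0 < c)
    (h : ∀ u, c * ‖ι u‖ ^ 2 ≤ (core.inner u u).re) :
    ∃ (V : Type u) (_ : NormedAddCommGroup V) (_ : InnerProductSpace ℂ V) (_ : CompleteSpace V)
      (i : D →ₗ[ℂ] V) (J : V →L[ℂ] H), DenseRange i ∧ (∀ u, J (i u) = ι u) ∧
      (∀ u v, inner ℂ (i u) (i v) = core.inner u v) ∧ ∀ w, c * ‖J w‖ ^ 2 ≤ ‖w‖ ^ 2 := by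
  -- With `D` abstract, the form norm is its only norm; on `S.domain` it would compete with the norm
  -- inherited from `H`.
  let : NormedAddCommGroup D := core.toNormedAddCommGroup
  let : InnerProductSpace ℂ D := InnerProductSpace.ofCore core.toCore
  have hnorm : ∀ u : D, c * ‖ι u‖ ^ 2 ≤ ‖u‖ ^ 2 := fun u => by
    rw [← inner_self_eq_norm_sq (𝕜 := ℂ) u]
    exact h u
  have hbd : ∀ u : D, ‖ι u‖ ≤ √c⁻¹ * ‖u‖ := fun u => by
    refine (abs_le_of_sq_le_sq' ?_ (by positivity)).2
    rw [mul_pow, Real.sq_sqrt (by positivity), inv_mul_eq_div, le_div_iff₀ hc, mul_comm]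
    exact hnorm u
  let ι' : D →L[ℂ] H := ι.mkContinuous _ hbd
  let i : D →L[ℂ] UniformSpace.Completion D := UniformSpace.Completion.toComplL
  have hi : DenseRange i := UniformSpace.Completion.denseRange_coe
  have hJ : ∀ u : D, ι'.extend i (i u) = ι u := fun u =>
    ContinuousLinearMap.extend_eq _ hi (UniformSpace.Completion.isUniformInducing_coe D) u
  refine ⟨UniformSpace.Completion D, inferInstance, inferInstance, inferInstance, i,
    ι'.extend i, hi, hJ, fun u v => UniformSpace.Completion.inner_coe (𝕜 := ℂ) (E := D) u v,
    fun w => ?_⟩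
  refine hi.induction_on (p := fun w => c * ‖ι'.extend i w‖ ^ 2 ≤ ‖w‖ ^ 2) w ?_ fun u => ?_
  · exact isClosed_le (by fun_prop) (by fun_prop)
  · rw [hJ]
    exact (hnorm u).trans_eq (congrArg (· ^ 2) (UniformSpace.Completion.norm_coe u).symm)

/-- The Friedrichs extension of a densely defined operator with lower bound `c > 0` is the inverse
of a positive bounded operator of norm at most `1 / c`. -/
lemma exists_inverse_friedrichsExtension [CompleteSpace H] (S : H →ₗ.[ℂ] H) (hS : IsSymmNonneg S)
    (hd : Dense (S.domain : Set H)) {c : ℝ} (hc : 0 < c)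
    (h : ∀ u : S.domain, c * ‖(u : H)‖ ^ 2 ≤ quadForm S u) :
    ∃ B : H →L[ℂ] H, B.IsPositive ∧ ‖B‖ ≤ c⁻¹ ∧
      (∀ y, ∃ hy : B y ∈ (friedrichsExtension S hS).domain,
        friedrichsExtension S hS ⟨B y, hy⟩ = y) ∧
      ∀ x : (friedrichsExtension S hS).domain, B (friedrichsExtension S hS x) = x := by
  obtain ⟨V, _, _, _, i, J, hi, hJ, hin, hn⟩ :=
    exists_core_completion (formCore S hS hc h) S.domain.subtype hc h
  replace hJ : ∀ u : S.domain, J (i u) = u := hJ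
  replace hin : ∀ u v : S.domain, inner ℂ (i u) (i v) = inner ℂ (u : H) (S v) := hin
  -- This extends `⟨v, S u⟩ = ⟨i v, i u⟩` from the dense range of `i` to all of `V`.
  have key : ∀ (w : V) (u : S.domain), inner ℂ (J w) (S u) = inner ℂ w (i u) := by
    intro w u
    refine hi.induction_on (p := fun w => inner ℂ (J w) (S u) = inner ℂ w (i u)) w ?_ fun v => ?_
    · exact isClosed_eq (by fun_prop) (by fun_prop)
    · rw [hJ, hin]
  have hq : ∀ u, quadForm S u = ‖i u‖ ^ 2 := fun u => by
    rw [← inner_self_eq_norm_sq (𝕜 := ℂ), hin]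
    rfl
  -- Form-Cauchy sequences are exactly those whose images under `i` are Cauchy in `V`, so the form
  -- domain is the range of `J`.
  have hform : ∀ x, x ∈ formDomain S hS ↔ ∃ w, J w = x := by
    intro x
    constructor
    · rintro ⟨u, hu, hu'⟩
      have hcs : CauchySeq fun n => i (u n) := by
        rw [cauchySeq_iff_tendsto_dist_atTop_0]
        have := hu'.sqrt
        simp only [hq, Real.sqrt_sq (norm_nonneg _), Real.sqrt_zero, map_sub] at this
        simpa only [dist_eq_norm] using this
      obtain ⟨w, hw⟩ := cauchySeq_tendsto_of_complete hcs
      refine ⟨w, tendsto_nhds_unique ((J.continuous.tendsto w).comp hw) ?_⟩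
      simpa only [Function.comp_def, hJ] using hu
    · rintro ⟨w, rfl⟩
      obtain ⟨x, hx, hxw⟩ := mem_closure_iff_seq_limit.1 (hi w)
      choose u hu using hx
      obtain rfl : (fun n => i (u n)) = x := funext hu
      refine ⟨u, by simpa only [Function.comp_def, hJ] using (J.continuous.tendsto w).comp hxw, ?_⟩
      have := (cauchySeq_iff_tendsto_dist_atTop_0.1 hxw.cauchySeq).pow 2
      simpa [hq, dist_eq_norm] using this
  -- The weak solution operator: `⟨y, u⟩ = ⟨J* y, i u⟩ = ⟨J J* y, S u⟩` says that `S* (B y) = y`.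
  let B : H →L[ℂ] H := J ∘L J.adjoint
  have hBadj : ∀ y (u : S.domain), inner ℂ y (u : H) = inner ℂ (B y) (S u) := fun y u => by
    rw [ContinuousLinearMap.comp_apply, key, ContinuousLinearMap.adjoint_inner_left, hJ]
  have hBdom : ∀ y, B y ∈ (friedrichsExtension S hS).domain := fun y =>
    ⟨(hform _).2 ⟨_, rfl⟩, LinearPMap.mem_adjoint_domain_of_exists _ ⟨y, hBadj y⟩⟩
  have hAB : ∀ y, friedrichsExtension S hS ⟨B y, hBdom y⟩ = y := fun y => by
    refine (LinearPMap.domRestrict_apply (y := ⟨B y, (hBdom y).2⟩) rfl).trans ?_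
    exact LinearPMap.adjoint_apply_eq hd _ (hBadj y)
  -- If `x = J w` and `S* x = 0`, then `w` is orthogonal to the dense range of `i`. Injectivity
  -- turns the right inverse `B` into a left inverse.
  have hinj : ∀ x : (friedrichsExtension S hS).domain, friedrichsExtension S hS x = 0 →
      x = 0 := by
    intro x hx
    obtain ⟨w, hw⟩ := (hform x).1 x.2.1
    have h0 : S.adjoint ⟨(x : H), x.2.2⟩ = 0 := hx
    have hw0 : w = 0 := by
      refine hi.eq_of_inner_left ℂ fun u => ?_
      have := LinearPMap.adjoint_isFormalAdjoint hd ⟨(x : H), x.2.2⟩ u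
      rw [h0, inner_zero_left] at this
      rw [← key, hw, inner_zero_left]
      exact this.symm
    rw [hw0, map_zero] at hw
    exact Subtype.ext hw.symm
  have hnJ : ‖J‖ ≤ √c⁻¹ := by
    refine J.opNorm_le_bound (by positivity) fun w => ?_
    refine abs_le_of_sq_le_sq' ?_ (by positivity) |>.2
    rw [mul_pow, Real.sq_sqrt (by positivity), inv_mul_eq_div, le_div_iff₀ hc, mul_comm]
    exact hn w
  refine ⟨B, ContinuousLinearMap.isPositive_self_comp_adjoint J, ?_, fun y => ⟨hBdom y, hAB y⟩,
    fun x => ?_⟩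
  · refine (ContinuousLinearMap.opNorm_comp_le _ _).trans ?_
    rw [LinearIsometryEquiv.norm_map, ← Real.mul_self_sqrt (inv_nonneg.2 hc.le)]
    gcongr
  · have := hinj (⟨B (friedrichsExtension S hS x), hBdom _⟩ - x) (by
      rw [LinearPMap.map_sub, hAB, sub_self])
    exact congrArg Subtype.val (sub_eq_zero.1 this)

/-- If a symmetric densely defined operator has lower bound `c > 0`, then so has the spectrum of
its Friedrichs extension. -/
theorem unboundedSpectrum_friedrichsExtension_subset [CompleteSpace H] (S : H →ₗ.[ℂ] H)
    (hS : IsSymmNonneg S) (hd : Dense (S.domain : Set H)) {c : ℝ} (hc : 0 < c)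
    (h : ∀ u : S.domain, c * ‖(u : H)‖ ^ 2 ≤ quadForm S u) :
    unboundedSpectrum (friedrichsExtension S hS) ⊆ (fun r : ℝ => (r : ℂ)) '' Ici c := by
  obtain ⟨B, hB, hBn, hAB, hBA⟩ := exists_inverse_friedrichsExtension S hS hd hc h
  set A := friedrichsExtension S hS
  intro z hz
  by_contra hzc
  refine hz ?_
  have hunit : IsUnit (1 - z • B) := by
    rcases eq_or_ne z 0 with rfl | hz0
    · simp
    rcases subsingleton_or_nontrivial H with _ | _
    · exact isUnit_of_subsingleton _
    by_contra hnu
    -- `1 - z B = z (z⁻¹ - B)`. As `B` is positive with norm at most `c⁻¹`, `z⁻¹` is then real in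
    -- `(0, c⁻¹]`, which puts `z` in `[c, ∞)`.
    have hmem : z⁻¹ ∈ spectrum ℂ B := by
      intro hu
      refine hnu ?_
      have := hu.smul (Units.mk0 z hz0)
      rwa [Units.smul_mk0, smul_sub, Algebra.algebraMap_eq_smul_one, smul_smul,
        mul_inv_cancel₀ hz0, one_smul] at this
    have hre := hB.isSelfAdjoint.mem_spectrum_eq_re hmem
    have hnn : 0 ≤ z⁻¹.re := by
      have := spectrum_nonneg_of_nonneg (𝕜 := ℝ) ((ContinuousLinearMap.nonneg_iff_isPositive B).2 hB)
        (x := z⁻¹.re) (by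
          rw [← spectrum.algebraMap_mem_iff ℂ]
          rw [hre] at hmem
          exact hmem)
      exact this
    have hle : z⁻¹.re ≤ c⁻¹ :=
      (Complex.re_le_norm _).trans ((spectrum.norm_le_norm_of_mem hmem).trans hBn)
    have hz' : z = ((z⁻¹.re⁻¹ : ℝ) : ℂ) := by
      rw [Complex.ofReal_inv, ← hre, inv_inv]
    have hpos : 0 < z⁻¹.re := by
      refine hnn.lt_of_ne fun h0 => hz0 ?_
      rw [hz', ← h0]
      simp
    exact hzc ⟨z⁻¹.re⁻¹, (le_inv_comm₀ hc hpos).2 hle, hz'.symm⟩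
  obtain ⟨T, hT1, hT2⟩ := hunit.exists_left_inv.imp fun T hT =>
    (⟨hT, by
      obtain ⟨T', hT'⟩ := hunit.exists_right_inv
      rwa [show T = T' by rw [← mul_one T, ← hT', ← mul_assoc, hT, one_mul]]⟩ :
        T * (1 - z • B) = 1 ∧ (1 - z • B) * T = 1)
  -- The resolvent is `B (1 - z B)⁻¹`, because `A - z = (1 - z B) A` on the domain of `A`.
  refine ⟨B ∘L T, fun y => ?_, fun x => ?_⟩
  · obtain ⟨hy, hy'⟩ := hAB (T y)
    refine ⟨hy, ?_⟩
    have := congrArg (fun R : H →L[ℂ] H => R y) hT2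
    simp only [mul_apply_eq_comp, sub_apply,
      one_apply_eq_self, smul_apply] at this
    exact (congrArg (· - z • B (T y)) hy').trans this
  · have hcomm : T (A x - z • (x : H)) = A x := by
      have := congrArg (fun R : H →L[ℂ] H => R (A x)) hT1
      simpa only [mul_apply_eq_comp, sub_apply,
        one_apply_eq_self, smul_apply, hBA x] using this
    rw [ContinuousLinearMap.comp_apply, hcomm, hBA]

end Friedrichs

/-! ### The minimal operator is densely defined -/

lemma aestronglyMeasurable_of_measurable_Icc {L : ℝ} {q : ℝ → ℝ}
    (hq : Measurable fun x : Icc 0 L => q x) :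
    AEStronglyMeasurable q (volume.restrict (Icc 0 L)) :=
  ((aemeasurable_restrict_iff_comap_subtype measurableSet_Icc).2
    hq.aemeasurable).aestronglyMeasurable

/-- A test function in the interior of an edge is in the domain of compactly supported functions. -/
lemma isDcom_single {M : ℕ} {l : Fin M → ℝ} (e : TreeEdge M) {Φ : ℝ → ℂ}
    (hΦ : ContDiff ℝ (⊤ : ℕ∞) Φ) (hs : HasCompactSupport Φ) (hsub : tsupport Φ ⊆ Ioo 0 (l e.2)) :
    IsDcom l (Pi.single e Φ) (Pi.single e (deriv Φ)) (Pi.single e (deriv (deriv Φ))) := by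
  have h1 : ContDiff ℝ (⊤ : ℕ∞) (deriv Φ) := hΦ.iterate_deriv 1
  have h2 : Continuous (deriv (deriv Φ)) := h1.continuous_deriv (by simp)
  have hv : ∀ x ∉ Ioo 0 (l e.2), Φ x = 0 := fun x hx =>
    image_eq_zero_of_notMem_tsupport fun h => hx (hsub h)
  have hv1 : ∀ x ∉ Ioo 0 (l e.2), deriv Φ x = 0 := fun x hx =>
    image_eq_zero_of_notMem_tsupport fun h => hx (hsub (tsupport_deriv_subset h))
  refine ⟨fun e' => ?_, ⟨0, fun v m => ?_⟩, fun v => ?_, ?_⟩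
  · rcases eq_or_ne e' e with rfl | he
    · simp only [Pi.single_eq_same]
      obtain ⟨C, hC⟩ :=
        ContDiff.lipschitzWith_of_hasCompactSupport hs.deriv h1 (by simp)
      refine ⟨fun x _ => ((hΦ.differentiable (by simp)) x).hasDerivAt.hasDerivWithinAt,
        hC.lipschitzOnWith.absolutelyContinuousOnInterval,
        Eventually.of_forall fun x => ((h1.differentiable (by simp)) x).hasDerivAt, ?_⟩
      exact (h2.memLp_of_hasCompactSupport hs.deriv.deriv).restrict _
    · simp only [Pi.single_eq_of_ne he]
      exact (IsDcom.zero l).isH2 e'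
  · rcases eq_or_ne (v, m) e with rfl | he
    · simp [hv]
    · simp [Pi.single_eq_of_ne he]
  · refine Finset.sum_eq_zero fun m _ => ?_
    have h3 : ∀ e' : TreeEdge M, ∀ x, x = 0 ∨ x = l e'.2 →
        (Pi.single e (deriv Φ) : TreeEdge M → ℝ → ℂ) e' x = 0 := by
      intro e' x hx
      rcases eq_or_ne e' e with rfl | he
      · rw [Pi.single_eq_same]
        exact hv1 x (by rcases hx with rfl | rfl <;> simp)
      · simp [Pi.single_eq_of_ne he]
    rw [h3 _ _ (Or.inl rfl), h3 _ _ (Or.inr rfl), sub_zero]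
  · refine (finite_singleton e).subset ?_
    rintro e' ⟨x, -, hx⟩
    by_contra he
    exact hx (by simp [Pi.single_eq_of_ne he])

/-- A vector orthogonal to the domain is orthogonal to every smooth function supported inside a
single edge, hence vanishes almost everywhere on each edge. Real test functions suffice. -/
lemma dense_minimalOp_domain {M : ℕ} {l : Fin M → ℝ} {q : Fin M → ℝ → ℝ}
    (hq_meas : ∀ m, Measurable (fun x : Icc (0 : ℝ) (l m) => q m x))
    (hq_bdd : ∃ C : ℝ, ∀ m, ∀ x ∈ Icc 0 (l m), |q m x| ≤ C) :
    Dense ((minimalOp l q).domain : Set (TreeL2 l)) := by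
  classical
  obtain ⟨C, hC⟩ := hq_bdd
  rw [Submodule.dense_iff_topologicalClosure_eq_top, Submodule.topologicalClosure_eq_top_iff,
    Submodule.eq_bot_iff]
  intro g hg
  rw [Submodule.mem_orthogonal] at hg
  ext1
  funext e
  refine Lp.ext ?_
  have hgi : LocallyIntegrableOn (g e) (Ioo 0 (l e.2)) :=
    (IntegrableOn.mono_set (t := Icc 0 (l e.2)) ((Lp.memLp (g e)).integrable (by norm_num))
      Ioo_subset_Icc_self).locallyIntegrableOn
  have key := isOpen_Ioo.ae_eq_zero_of_integral_contDiff_smul_eq_zero hgi fun φ hφ hs hsub => by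
    have hΦ : ContDiff ℝ (⊤ : ℕ∞) fun x => (φ x : ℂ) := Complex.ofRealCLM.contDiff.comp hφ
    have hsΦ : HasCompactSupport fun x => (φ x : ℂ) := hs.comp_left (g := ((↑) : ℝ → ℂ)) rfl
    have hsubΦ : tsupport (fun x => (φ x : ℂ)) ⊆ Ioo 0 (l e.2) :=
      (closure_mono (Function.support_subset_iff'.2 fun x hx => by
        simpa using hx)).trans hsub
    have hD := isDcom_single e hΦ hsΦ hsubΦ
    have hmem : MemLp (fun x => (φ x : ℂ)) 2 (volume.restrict (Icc 0 (l e.2))) :=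
      (hΦ.continuous.memLp_of_hasCompactSupport hsΦ).restrict _
    -- The potential is essentially bounded, so `-φ'' + q φ` is in `L²` and the test function does
    -- belong to the domain.
    have hq : MemLp (fun x => (q e.2 x : ℂ)) ⊤ (volume.restrict (Icc 0 (l e.2))) := by
      refine memLp_top_of_bound (Complex.continuous_ofReal.comp_aestronglyMeasurable
        (aestronglyMeasurable_of_measurable_Icc (hq_meas e.2))) C ?_
      filter_upwards [ae_restrict_mem measurableSet_Icc] with x hx
      simpa using hC e.2 x hx
    have h2 : MemLp (fun x => -deriv (deriv fun x => (φ x : ℂ)) x + q e.2 x * (φ x : ℂ)) 2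
        (volume.restrict (Icc 0 (l e.2))) := by
      have := (hD.isH2 e).memLp
      rw [Pi.single_eq_same] at this
      exact this.neg.add (hmem.mul hq)
    have hdom : (lp.single 2 e (hmem.toLp _) : TreeL2 l) ∈ (minimalOp l q).domain := by
      rw [minimalOp, Submodule.toLinearPMap_domain]
      refine ⟨(lp.single 2 e (hmem.toLp _), lp.single 2 e (h2.toLp _)), ⟨_, _, _, hD, ?_⟩, rfl⟩
      intro e'
      rcases eq_or_ne e' e with rfl | he
      · simp only [lp.single_apply_self, Pi.single_eq_same]
        exact ⟨hmem.coeFn_toLp, h2.coeFn_toLp⟩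
      · simp only [lp.single_apply_ne _ _ _ he, Pi.single_eq_of_ne he]
        exact ⟨Lp.coeFn_zero _ _ _, by
          simp only [Pi.zero_apply, neg_zero, mul_zero, add_zero]
          exact Lp.coeFn_zero _ _ _⟩
    have h0 := hg _ hdom
    rw [lp.inner_single_left, L2.inner_def] at h0
    rw [← setIntegral_eq_integral_of_forall_compl_eq_zero (s := Icc 0 (l e.2)), ← h0]
    · refine integral_congr_ae ?_
      filter_upwards [hmem.coeFn_toLp] with x hx
      rw [hx, RCLike.inner_apply, Complex.conj_ofReal, Complex.real_smul, mul_comm]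
    · intro x hx
      rw [image_eq_zero_of_notMem_tsupport fun h => hx (Ioo_subset_Icc_self (hsub h)), zero_smul]
  filter_upwards [ae_restrict_of_ae key, ae_interior (l e.2),
    Lp.coeFn_zero ℂ 2 (volume.restrict (Icc 0 (l e.2)))] with x h1 h2 h3
  exact (h1 h2).trans h3.symm

/-! ### The spectral gap -/

/-! ### Weighted inequality on one edge -/

/-- Integrate the derivative `‖F‖ ^ 2 + 2 (x + b) ⟨F, F'⟩` of `(x + b) ‖F‖ ^ 2` and absorb the cross
term through `2 K s t ≤ s ^ 2 / 2 + 2 K ^ 2 t ^ 2`. The offset `b` stays free so that it can be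
tuned edge by edge. -/
lemma edge_poincare {L b K : ℝ} (hL : 0 < L) {F F₁ : ℝ → ℂ}
    (hF : ∀ x ∈ Icc 0 L, HasDerivWithinAt F (F₁ x) (Icc 0 L) x) (hF₁ : ContinuousOn F₁ (Icc 0 L))
    (hK : ∀ x ∈ Icc 0 L, |x + b| ≤ K) :
    1 / 2 * ∫ x in Icc 0 L, ‖F x‖ ^ 2 ≤
      ((L + b) * ‖F L‖ ^ 2 - b * ‖F 0‖ ^ 2) + 2 * K ^ 2 * ∫ x in Icc 0 L, ‖F₁ x‖ ^ 2 := by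
  have hFc : ContinuousOn F (Icc 0 L) := fun x hx => (hF x hx).continuousWithinAt
  have hic : ContinuousOn (fun x => ‖F x‖ ^ 2 + (x + b) * (2 * inner ℝ (F x) (F₁ x))) (Icc 0 L) := by
    fun_prop
  have ftc := intervalIntegral.integral_eq_sub_of_hasDerivAt_of_le hL.le
    (f := fun x => (x + b) * ‖F x‖ ^ 2)
    (f' := fun x => ‖F x‖ ^ 2 + (x + b) * (2 * inner ℝ (F x) (F₁ x))) (by fun_prop)
    (fun x hx => by
      have h1 := (hF x (Ioo_subset_Icc_self hx)).hasDerivAt (Icc_mem_nhds hx.1 hx.2)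
      have h2 := ((hasDerivAt_id' x).add_const b).mul h1.norm_sq
      rw [one_mul] at h2
      exact h2)
    (hic.intervalIntegrable_of_Icc hL.le)
  rw [intervalIntegral.integral_of_le hL.le, ← integral_Icc_eq_integral_Ioc, zero_add] at ftc
  have i1 : IntegrableOn (fun x => ‖F x‖ ^ 2) (Icc 0 L) :=
    (hFc.norm.pow 2).integrableOn_compact isCompact_Icc
  have i2 : IntegrableOn (fun x => ‖F₁ x‖ ^ 2) (Icc 0 L) :=
    (hF₁.norm.pow 2).integrableOn_compact isCompact_Icc
  rw [← ftc, ← integral_const_mul, ← integral_const_mul,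
    ← integral_add (hic.integrableOn_compact isCompact_Icc) (i2.const_mul _)]
  refine setIntegral_mono_on (i1.const_mul _)
    ((hic.integrableOn_compact isCompact_Icc).add (i2.const_mul _)) measurableSet_Icc fun x hx => ?_
  have h1 : |(x + b) * inner ℝ (F x) (F₁ x)| ≤ K * (‖F x‖ * ‖F₁ x‖) := by
    rw [abs_mul]
    exact mul_le_mul (hK x hx) (abs_real_inner_le_norm _ _) (abs_nonneg _)
      ((abs_nonneg _).trans (hK x hx))
  have h2 := (abs_le.1 h1).1
  nlinarith [sq_nonneg (‖F x‖ - 2 * K * ‖F₁ x‖)]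

/-! ### The outward flow on the tree -/

/-- Appending `a⁻¹` to a reduced word not ending in `a` causes no cancellation. Geometrically, the
edge from `v * a⁻¹` to `v` then points towards the root. -/
lemma getLast?_toWord_mul_inv_of {α : Type*} [DecidableEq α] (v : FreeGroup α) (a : α)
    (h : v.toWord.getLast? ≠ some (a, true)) :
    (v * (FreeGroup.of a)⁻¹).toWord.getLast? = some (a, false) := by
  have hr : FreeGroup.IsReduced (v.toWord ++ [(a, false)]) := by
    refine List.isChain_append.2 ⟨FreeGroup.isReduced_toWord, .singleton _, ?_⟩
    rintro ⟨b, c⟩ hx y hy hb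
    simp only [List.head?_cons, Option.mem_def, Option.some.injEq] at hx hy
    subst hy
    simp only at hb
    subst hb
    -- Reducedness asks equal neighbouring letters to have equal signs; the sign `true` is the case
    -- excluded by `h`.
    cases c
    · rfl
    · exact absurd hx h
  rw [FreeGroup.toWord_mul, FreeGroup.toWord_inv, FreeGroup.toWord_of]
  simp [FreeGroup.invRev, hr.reduce_eq]

/-- The value at the initial vertex of a function of slope `1` on each edge which points away from
the root of the tree. -/
def flowOffset {M : ℕ} (l : Fin M → ℝ) (A : ℝ) (e : TreeEdge M) : ℝ :=
  if e.1.toWord.getLast? = some (e.2, false) then -A - l e.2 else A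

/-- The field runs from `A` to `A + l` on edges pointing away from the root, and from `-A - l` to
`-A` on the others. -/
lemma abs_add_flowOffset_le {M : ℕ} {l : Fin M → ℝ} {A : ℝ} (hA : ∀ m, l m ≤ A) (e : TreeEdge M)
    {x : ℝ} (hx : x ∈ Icc 0 (l e.2)) : |x + flowOffset l A e| ≤ 2 * A := by
  have := hA e.2
  obtain ⟨h1, h2⟩ := hx
  rw [abs_le, flowOffset]
  split_ifs <;> constructor <;> linarith

/-- The net flux at each vertex is outwards. -/
lemma sum_flowOffset_nonpos {M : ℕ} (hM : 2 ≤ M) {l : Fin M → ℝ} {A : ℝ} (hA0 : 0 ≤ A)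
    (hA : ∀ m, l m ≤ A) (v : FreeGroup (Fin M)) :
    ∑ m, ((l m + flowOffset l A (v * (FreeGroup.of m)⁻¹, m)) - flowOffset l A (v, m)) ≤ 0 := by
  -- Type `m` has two edge ends at `v`. Each contributes `-A` if it leads away from the root and at
  -- most `2 * A` if it leads back; the difference is the `3 * A`.
  have h1 : ∀ m, (l m + flowOffset l A (v * (FreeGroup.of m)⁻¹, m)) - flowOffset l A (v, m) ≤
      -2 * A + 3 * A * ((if v.toWord.getLast? = some (m, true) then 1 else 0) +
        (if v.toWord.getLast? = some (m, false) then 1 else 0)) := by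
    intro m
    have hm := hA m
    have h2 : l m + flowOffset l A (v * (FreeGroup.of m)⁻¹, m) ≤
        -A + 3 * A * (if v.toWord.getLast? = some (m, true) then 1 else 0) := by
      by_cases h : v.toWord.getLast? = some (m, true)
      · rw [if_pos h, flowOffset]
        split_ifs <;> linarith
      · rw [if_neg h, flowOffset, if_pos (getLast?_toWord_mul_inv_of v m h)]
        linarith
    have h3 : -flowOffset l A (v, m) ≤
        -A + 3 * A * (if v.toWord.getLast? = some (m, false) then 1 else 0) := by
      rw [flowOffset]
      split_ifs <;> linarith
    linarith
  -- At most one edge at `v` leads to the root, the one given by the last letter of `v`; there is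
  -- none when `v = 1`.
  have h4 : ∑ m, (((if v.toWord.getLast? = some (m, true) then 1 else 0) +
      (if v.toWord.getLast? = some (m, false) then 1 else 0) : ℝ)) ≤ 1 := by
    rcases v.toWord.getLast? with _ | ⟨k, _ | _⟩ <;> simp
  refine (Finset.sum_le_sum fun m _ => h1 m).trans ?_
  rw [Finset.sum_add_distrib, Finset.sum_const, Finset.card_univ,
    Fintype.card_fin, nsmul_eq_mul, ← Finset.mul_sum]
  have h5 : (2 : ℝ) ≤ M := by exact_mod_cast hM
  -- The total is at most `-2 * M * A + 3 * A ≤ -A`; this is where `M ≥ 2` enters.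
  nlinarith [mul_le_mul_of_nonneg_left h4 hA0, mul_le_mul_of_nonneg_right h5 hA0]

/-! ### Summation over the edges -/

lemma boundary_flow_summable {M : ℕ} {l : Fin M → ℝ} (hl : ∀ m, 0 < l m) (b : TreeEdge M → ℝ)
    {F F₁ F₂ : TreeEdge M → ℝ → ℂ} (hF : IsDcom l F F₁ F₂) :
    (Summable fun e : TreeEdge M => (l e.2 + b e) * ‖F e (l e.2)‖ ^ 2) ∧
      Summable fun e : TreeEdge M => b e * ‖F e 0‖ ^ 2 := by
  constructor
  · refine summable_of_hasFiniteSupport (hF.compactSupport.subset fun e he => ?_)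
    exact ⟨l e.2, ⟨(hl e.2).le, le_rfl⟩, fun h => he (by simp [h])⟩
  · refine summable_of_hasFiniteSupport (hF.compactSupport.subset fun e he => ?_)
    exact ⟨0, ⟨le_rfl, (hl e.2).le⟩, fun h => he (by simp [h])⟩

/-- Regrouped by vertices, the sum is `‖φ v‖ ^ 2` times the net inward flux at `v`, since continuity
gives all edge ends at `v` the same value. -/
lemma boundary_flow_nonpos {M : ℕ} (hM : 2 ≤ M) {l : Fin M → ℝ} (hl : ∀ m, 0 < l m) {A : ℝ}
    (hA0 : 0 ≤ A) (hA : ∀ m, l m ≤ A) {F F₁ F₂ : TreeEdge M → ℝ → ℂ} (hF : IsDcom l F F₁ F₂) :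
    ∑' e : TreeEdge M, ((l e.2 + flowOffset l A e) * ‖F e (l e.2)‖ ^ 2 -
      flowOffset l A e * ‖F e 0‖ ^ 2) ≤ 0 := by
  obtain ⟨φ, hφ⟩ := hF.continuous_vertex
  obtain ⟨hs, hs'⟩ := boundary_flow_summable hl (flowOffset l A) hF
  -- It sends the edge of type `m` starting at `v` to the one ending at `v`.
  let σ : TreeEdge M ≃ TreeEdge M :=
    { toFun := fun e => (e.1 * (FreeGroup.of e.2)⁻¹, e.2)
      invFun := fun e => (e.1 * FreeGroup.of e.2, e.2)
      left_inv := fun e => by simp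
      right_inv := fun e => by simp }
  have hσ := σ.summable_iff.2 hs
  rw [hs.tsum_sub hs', ← σ.tsum_eq]
  refine (hσ.tsum_sub hs').symm.trans_le ?_
  rw [(hσ.sub hs').tsum_prod]
  refine tsum_nonpos fun v => ?_
  rw [tsum_fintype]
  have h := mul_nonpos_of_nonneg_of_nonpos (sq_nonneg ‖φ v‖) (sum_flowOffset_nonpos hM hA0 hA v)
  rw [Finset.mul_sum] at h
  refine (Finset.sum_congr rfl fun m _ => ?_).trans_le h
  have h1 : F (v * (FreeGroup.of m)⁻¹, m) (l m) = φ v := by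
    rw [(hφ _ m).2, inv_mul_cancel_right]
  simp only [σ, Equiv.coe_fn_mk, Function.comp, h1, (hφ v m).1]
  ring

/-- The Poincaré inequality on the metric tree, for functions of compact support. -/
lemma tree_poincare {M : ℕ} (hM : 2 ≤ M) {l : Fin M → ℝ} (hl : ∀ m, 0 < l m) {A : ℝ}
    (hA0 : 0 ≤ A) (hA : ∀ m, l m ≤ A) {F F₁ F₂ : TreeEdge M → ℝ → ℂ} (hF : IsDcom l F F₁ F₂) :
    ∑' e : TreeEdge M, ∫ x in Icc 0 (l e.2), ‖F e x‖ ^ 2 ≤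
      16 * A ^ 2 * ∑' e : TreeEdge M, ∫ x in Icc 0 (l e.2), ‖F₁ e x‖ ^ 2 := by
  have hz : ∀ e ∉ {e : TreeEdge M | ∃ x ∈ Icc 0 (l e.2), F e x ≠ 0},
      ∀ x ∈ Icc 0 (l e.2), F e x = 0 := fun e he => by
    simpa only [mem_ofPred_eq, not_exists, not_and, not_not] using he
  have s1 : Summable fun e : TreeEdge M => ∫ x in Icc 0 (l e.2), ‖F e x‖ ^ 2 := by
    refine summable_of_hasFiniteSupport (hF.compactSupport.subset fun e he => ?_)
    by_contra hc
    exact he (setIntegral_eq_zero_of_forall_eq_zero fun x hx => by simp [hz e hc x hx])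
  have s2 : Summable fun e : TreeEdge M => ∫ x in Icc 0 (l e.2), ‖F₁ e x‖ ^ 2 := by
    refine summable_of_hasFiniteSupport (hF.compactSupport.subset fun e he => ?_)
    by_contra hc
    exact he (setIntegral_eq_zero_of_forall_eq_zero fun x hx => by
      simp [((hF.isH2 e).eq_zero (hl e.2) (hz e hc)).1 x hx])
  obtain ⟨hs, hs'⟩ := boundary_flow_summable hl (flowOffset l A) hF
  -- Here `K = 2 * A`, so `2 * K ^ 2 = 8 * A ^ 2`; clearing the factor `1 / 2` gives `16 * A ^ 2`.
  have h := Summable.tsum_le_tsum (fun e : TreeEdge M =>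
    edge_poincare (hl e.2) (hF.isH2 e).hasDeriv ((hF.isH2 e).continuousOn₁ (hl e.2))
      fun x hx => abs_add_flowOffset_le hA e hx)
    (s1.mul_left _) ((hs.sub hs').add (s2.mul_left _))
  rw [tsum_mul_left, (hs.sub hs').tsum_add (s2.mul_left _), tsum_mul_left] at h
  have := boundary_flow_nonpos hM hl hA0 hA hF
  linarith

/-! ### Lower bound for the quadratic form -/

lemma quadForm_minimalOp_eq {M : ℕ} {l : Fin M → ℝ} (hl : ∀ m, 0 < l m) (q : Fin M → ℝ → ℝ)
    {F F₁ F₂ : TreeEdge M → ℝ → ℂ} (hF : IsDcom l F F₁ F₂) (x : (minimalOp l q).domain)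
    (h : ∀ e, (x : TreeL2 l) e =ᵐ[volume.restrict (Icc 0 (l e.2))] F e ∧
      minimalOp l q x e =ᵐ[volume.restrict (Icc 0 (l e.2))]
        fun t => -F₂ e t + q e.2 t * F e t) :
    quadForm (minimalOp l q) x = ∑' e : TreeEdge M,
      ∫ t in Icc 0 (l e.2), (‖F₁ e t‖ ^ 2 + q e.2 t * ‖F e t‖ ^ 2) := by
  rw [quadForm, inner_eq_form hl q hF hF x _ (fun e => (h e).1) (fun e => (h e).2)]
  have he : ∀ e : TreeEdge M, edgeForm (l e.2) (q e.2) (F e) (F₁ e) (F e) (F₁ e) =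
      ((∫ t in Icc 0 (l e.2), (‖F₁ e t‖ ^ 2 + q e.2 t * ‖F e t‖ ^ 2) : ℝ) : ℂ) := fun e => by
    rw [edgeForm, ← integral_complex_ofReal]
    congr 1
    funext t
    rw [Complex.conj_mul', Complex.conj_mul']
    push_cast
    ring
  rw [tsum_congr he, ← Complex.ofReal_tsum, Complex.ofReal_re]

lemma norm_sq_treeL2_eq {M : ℕ} {l : Fin M → ℝ} (f : TreeL2 l) {F : TreeEdge M → ℝ → ℂ}
    (h : ∀ e, f e =ᵐ[volume.restrict (Icc 0 (l e.2))] F e) :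
    ‖f‖ ^ 2 = ∑' e : TreeEdge M, ∫ x in Icc 0 (l e.2), ‖F e x‖ ^ 2 := by
  have h1 : ∀ e, inner ℂ (f e) (f e) =
      ((∫ x in Icc 0 (l e.2), ‖F e x‖ ^ 2 : ℝ) : ℂ) := fun e => by
    rw [L2.inner_def, ← integral_complex_ofReal]
    refine integral_congr_ae ?_
    filter_upwards [h e] with x hx
    rw [hx, inner_self_eq_norm_sq_to_K]
    simp
  have h2 := inner_self_eq_norm_sq_to_K (𝕜 := ℂ) f
  rw [lp.inner_eq_tsum, tsum_congr h1, ← Complex.ofReal_tsum] at h2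
  have h3 := congrArg Complex.re h2
  rw [Complex.ofReal_re] at h3
  rw [h3]
  norm_cast

/-- The quadratic form of the minimal operator has a positive lower bound. -/
lemma minimalOp_lower_bound {M : ℕ} (hM : 2 ≤ M) {l : Fin M → ℝ} (hl : ∀ m, 0 < l m)
    {q : Fin M → ℝ → ℝ} (hq_meas : ∀ m, Measurable (fun x : Icc (0 : ℝ) (l m) => q m x))
    (hq_bdd : ∃ C : ℝ, ∀ m, ∀ x ∈ Icc 0 (l m), |q m x| ≤ C)
    (hq : ∀ m, ∀ x ∈ Icc 0 (l m), 0 ≤ q m x) {A : ℝ} (hA0 : 0 < A) (hA : ∀ m, l m ≤ A)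
    (u : (minimalOp l q).domain) :
    (16 * A ^ 2)⁻¹ * ‖(u : TreeL2 l)‖ ^ 2 ≤ quadForm (minimalOp l q) u := by
  obtain ⟨C, hC⟩ := hq_bdd
  obtain ⟨F, F₁, F₂, hF, hu⟩ := minimalOp_mem hl q u
  rw [quadForm_minimalOp_eq hl q hF u hu, norm_sq_treeL2_eq _ fun e => (hu e).1,
    inv_mul_le_iff₀ (by positivity)]
  refine (tree_poincare hM hl hA0.le hA hF).trans ?_
  have hz : ∀ e ∉ {e : TreeEdge M | ∃ x ∈ Icc 0 (l e.2), F e x ≠ 0},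
      ∀ x ∈ Icc 0 (l e.2), F e x = 0 ∧ F₁ e x = 0 := fun e he => by
    simp only [mem_ofPred_eq, not_exists, not_and, not_not] at he
    exact fun x hx => ⟨he x hx, ((hF.isH2 e).eq_zero (hl e.2) he).1 x hx⟩
  have i1 : ∀ e, IntegrableOn (fun x => ‖F₁ e x‖ ^ 2) (Icc 0 (l e.2)) := fun e =>
    (((hF.isH2 e).continuousOn₁ (hl e.2)).norm.pow 2).integrableOn_compact isCompact_Icc
  have i2 : ∀ e, IntegrableOn (fun x => q e.2 x * ‖F e x‖ ^ 2) (Icc 0 (l e.2)) := fun e => by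
    refine Integrable.bdd_mul (c := C)
      (((hF.isH2 e).continuousOn.norm.pow 2).integrableOn_compact isCompact_Icc)
      (aestronglyMeasurable_of_measurable_Icc (hq_meas e.2)) ?_
    filter_upwards [ae_restrict_mem measurableSet_Icc] with x hx using hC e.2 x hx
  gcongr ?_ * ?_
  refine Summable.tsum_le_tsum (fun e => ?_) ?_ ?_
  · refine setIntegral_mono_on (i1 e) ((i1 e).add (i2 e)) measurableSet_Icc fun x hx => ?_
    -- The potential only increases the form.
    exact le_add_of_nonneg_right (mul_nonneg (hq e.2 x hx) (sq_nonneg _))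
  all_goals
    refine summable_of_hasFiniteSupport (hF.compactSupport.subset fun e he => ?_)
    by_contra hc
    exact he (setIntegral_eq_zero_of_forall_eq_zero fun x hx => by simp [hz e hc x hx])

end

theorem mainTheorem9 (M : ℕ) (hM : 2 ≤ M) (l : Fin M → ℝ) (hl : ∀ m, 0 < l m)
    (q : Fin M → ℝ → ℝ)
    (hq_meas : ∀ m, Measurable (fun x : Set.Icc (0 : ℝ) (l m) => q m x))
    (hq_bdd : ∃ C : ℝ, ∀ m, ∀ x ∈ Set.Icc 0 (l m), |q m x| ≤ C)
    (hq_even : ∀ m, ∀ x ∈ Set.Icc 0 (l m), q m (l m - x) = q m x)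
    (hq_nonneg : ∀ m, ∀ x ∈ Set.Icc 0 (l m), 0 ≤ q m x) :
    ∃ c : ℝ, 0 < c ∧ unboundedSpectrum (treeOperator l q hl hq_nonneg) ⊆
      (fun r : ℝ => (r : ℂ)) '' Set.Ici c := by
  -- Any common bound `A` for the edge lengths would do; the sum is a convenient one.
  have hA : ∀ m, l m ≤ ∑ k, l k := fun m =>
    Finset.single_le_sum (fun k _ => (hl k).le) (Finset.mem_univ m)
  have hA0 : 0 < ∑ k, l k := (hl ⟨0, by lia⟩).trans_le (hA _)
  exact ⟨(16 * (∑ k, l k) ^ 2)⁻¹, by positivity,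
    unboundedSpectrum_friedrichsExtension_subset _ _ (dense_minimalOp_domain hq_meas hq_bdd)
      (by positivity) (minimalOp_lower_bound hM hl hq_meas hq_bdd hq_nonneg hA0 hA)⟩
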